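/- For a dataset $X=(x_{ij})\in\{\pm1\}^{n\times d}$ let $q_j=\frac1n\sum_{i=1}^n x_{ij}$ denote its $j$-th marginal. A vector $t\in\{0,1\}^d$ is an $\alpha$-accurate top-$k$ vector of $X$ if it has exactly $k$ entries equal to $1$ and $q_j\ge\tau-\alpha$ whenever $t_j=1$, where $\tau$ is the $k$-th largest value among $q_1,\dots,q_d$. A randomized algorithm $M:\{\pm1\}^{n\times d}\to\{0,1\}^d$ is $(\varepsilon,\delta)$-differentially private if $\Pr[M(X)\in S]\le e^{\varepsilon}\Pr[M(X')\in S]+\delta$ for every $S\subseteq\{0,1\}^d$ and all $X,X'$ that differ in at most one row. **Theorem.** Let $\varepsilon,\delta,\beta\ge0$ with $\delta+\beta<1$. There are functions $n=n(d,k)\in\mathbb N$ and $\alpha=\alpha(d,k)\in\mathbb R$ with $n=\Omega(k\log d)$ and $\alpha=\Omega(\sqrt{\log(d)/n})$ (that is, $n\ge c\,k\log d$ and $\alpha\ge c\sqrt{\log(d)/n}$ for all $d,k$, with a constant $c>0$; the functions and $c$ may depend on $\varepsilon,\delta,\beta$) such that for every function $k=k(d)\in\mathbb N$ with $k=d^{o(1)}$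 as $d\to\infty$ and for every sufficiently large $d$, there is no $(\varepsilon,\delta)$-differentially private algorithm $M:\{\pm1\}^{n\times d}\to\{0,1\}^d$, with $n=n(d,k)$, that for every dataset $X\in\{\pm1\}^{n\times d}$ outputs an $\alpha(d,k)$-accurate top-$k$ vector of $X$ with probability at least $1-\beta$. -/

import Mathlib

open Filter Topology

noncomputable section

namespace TopK

/-- Datasets in `{±1}^{n × d}`: `n` rows (individuals) and `d` columns (attributes).
The type `ℤˣ` consists of exactly the two elements `1` and `-1`. -/
abbrev Dataset (n d : ℕ) : Type := Fin n → Fin d → ℤˣ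

/-- The marginal (column mean) `q_j = (1/n) ∑ᵢ x_{ij}`. -/
def marginal {n d : ℕ} (X : Dataset n d) (j : Fin d) : ℝ :=
  (1 / (n : ℝ)) * ∑ i : Fin n, (((X i j : ℤˣ) : ℤ) : ℝ)

/-- The `k`-th largest value among the coordinates of `q`, counted with multiplicity: the largest
`τ` such that at least `k` coordinates are `≥ τ` (a maximum when `1 ≤ k ≤ d`). -/
def kthLargest {d : ℕ} (k : ℕ) (q : Fin d → ℝ) : ℝ :=
  sSup {τ : ℝ | k ≤ (Finset.univ.filter fun j => τ ≤ q j).card}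

/-- `t ∈ {0,1}^d` is an `α`-accurate top-`k` vector of `X`: it selects exactly `k` columns, and
each selected column has marginal at least `τ - α`, where `τ` is the `k`-th largest marginal. -/
def IsAccurateTopK {n d : ℕ} (k : ℕ) (α : ℝ) (X : Dataset n d) (t : Fin d → Bool) : Prop :=
  (Finset.univ.filter fun j => t j = true).card = k ∧
    ∀ j, t j = true → kthLargest k (marginal X) - α ≤ marginal X j

/-- A randomized algorithm taking a dataset and returning a random vector in `{0,1}^d`. -/
abbrev Mechanism (n d : ℕ) : Type := Dataset n d → PMF (Fin d → Bool)

/-- The probability of the event `S` under the distribution `p`. -/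
def prob {Ω : Type*} (p : PMF Ω) (S : Set Ω) : ℝ := (p.toOuterMeasure S).toReal

/-- Two datasets are neighbouring if they agree on all rows except possibly one. -/
def Neighbouring {n d : ℕ} (X X' : Dataset n d) : Prop :=
  ∃ i : Fin n, ∀ i' : Fin n, i' ≠ i → X i' = X' i'

/-- `(ε, δ)`-differential privacy. -/
def IsDifferentiallyPrivate {n d : ℕ} (ε δ : ℝ) (M : Mechanism n d) : Prop :=
  ∀ X X' : Dataset n d, Neighbouring X X' → ∀ S : Set (Fin d → Bool),
    prob (M X) S ≤ Real.exp ε * prob (M X') S + δ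

/-- On every dataset, with probability at least `1 - β`, the output is an `α`-accurate top-`k`
vector of that dataset. -/
def SolvesTopK {n d : ℕ} (k : ℕ) (α β : ℝ) (M : Mechanism n d) : Prop :=
  ∀ X : Dataset n d, 1 - β ≤ prob (M X) {t | IsAccurateTopK k α X t}

/-- `k = d^{o(1)}` as `d → ∞`. -/
def IsSubpolynomial (k : ℕ → ℕ) : Prop :=
  ∃ e : ℕ → ℝ, Tendsto e atTop (𝓝 0) ∧ ∀ᶠ d : ℕ in atTop, (k d : ℝ) = (d : ℝ) ^ e d

end TopK

end

/-!
Why private top-`k` selection fails at the sampling threshold.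

The lower bound holds on random data. Let the rows of the dataset be independent, and let `A T` be
tests that a fresh row passes with probability at most `ρ`, for each *fixed* output `T`. By
differential privacy, row `i` of the input passes the test for the actual output with probability at
most `exp ε * ρ + δ`: the output barely changes when row `i` is replaced by a constant row, and then
it no longer depends on row `i` (`sum_mul_prob_test_le`). So if with high probability over the data
*every* accurate output passes its test on nearly all rows, privacy and accuracy contradict each
other (`not_exists_mechanism_of_test`). Since `δ` may be a constant, the test has to succeed on a
fraction of the rows close to `1`. There are two regimes.

* For bounded `k` the entries equal `1` with a small constant probability `p`. If `n` is a small
  multiple of `log d`, then `d * p ^ n` is a power of `d`, so at least `k` columns consist of ones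
  only. Hence every selected column is almost all ones, whereas a fresh row has a `1` in a given
  column with probability only `p` (`not_exists_mechanism_of_sparse`).

* For large `k` the entries are uniform signs and `n` is a small multiple of `k * log d`. Then the
  `k`-th largest column sum is at least `(1 - η) √(2 n log d)` (`exp_le_mass_uniformSign_sqrt`,
  `mass_card_columns_lt_le`), and the selected columns have sums almost as large. The test is that
  the row sums over the selected columns reach half of the average that this forces. That average
  is a large multiple of `√k`, so a fresh row rarely passes. If a fraction `b` of the rows failed,
  the remaining rows would carry more than their share, and Hoeffding's inequality makes this so
  unlikely, by a factor `d ^ (-k (1 + b ^ 2 / 8))`, that a union bound over the at most `d ^ k`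
  selections and the `2 ^ n` sets of failing rows applies (`mass_exists_rectangle_le`). The leading
  constants in the upper and lower tail bounds agree, which is what makes the union bound close.

Probabilities over the data are finite sums of weights.
-/

noncomputable section

namespace TopK

/-! ### Finite product distributions -/

/-- The weight that `w` gives to a set `A`. For a probability vector `w` this is the probability of
the event `A`. -/
def mass {α : Type*} [Fintype α] (w : α → ℝ) (A : Set α) : ℝ := ∑ a, A.indicator w a

/-- The product weight on functions `ι → α` whose coordinates are independent with weight `w`. -/
def prodWeight {ι α : Type*} [Fintype ι] (w : α → ℝ) (x : ι → α) : ℝ := ∏ i, w (x i)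

/-- The distribution on `{±1}` giving probability `p` to `1`. -/
def signWeight (p : ℝ) (u : ℤˣ) : ℝ := if u = 1 then p else 1 - p

lemma sum_units (f : ℤˣ → ℝ) : ∑ u, f u = f 1 + f (-1) := by
  rw [UnitsInt.univ, Finset.sum_pair (by decide)]

lemma signWeight_nonneg {p : ℝ} (h0 : 0 ≤ p) (h1 : p ≤ 1) (u : ℤˣ) : 0 ≤ signWeight p u := by
  unfold signWeight
  split_ifs <;> linarith

lemma signWeight_one (p : ℝ) : signWeight p 1 = p := by simp [signWeight]

lemma signWeight_neg_one (p : ℝ) : signWeight p (-1) = 1 - p := by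
  rw [signWeight, if_neg (by decide)]

lemma sum_signWeight (p : ℝ) : ∑ u, signWeight p u = 1 := by
  rw [sum_units, signWeight_one, signWeight_neg_one]; ring

lemma prodWeight_nonneg {ι α : Type*} [Fintype ι] {w : α → ℝ} (hw : ∀ a, 0 ≤ w a) (x : ι → α) :
    0 ≤ prodWeight w x :=
  Finset.prod_nonneg fun i _ => hw (x i)

section mass

variable {α ι : Type*} [Fintype α] [Fintype ι] {w : α → ℝ}

lemma mass_mono (hw : ∀ a, 0 ≤ w a) {A B : Set α} (h : A ⊆ B) : mass w A ≤ mass w B :=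
  Finset.sum_le_sum fun a _ => Set.indicator_le_indicator_of_subset h hw a

lemma mass_add_mass_compl (A : Set α) : mass w A + mass w Aᶜ = ∑ a, w a := by
  unfold mass
  rw [← Finset.sum_add_distrib]
  exact Finset.sum_congr rfl fun a _ => congrFun (Set.indicator_self_add_compl A w) a

lemma mass_union_le (hw : ∀ a, 0 ≤ w a) (A B : Set α) :
    mass w (A ∪ B) ≤ mass w A + mass w B := by
  unfold mass
  rw [← Finset.sum_add_distrib]
  refine Finset.sum_le_sum fun a _ => ?_
  by_cases hA : a ∈ A <;> by_cases hB : a ∈ B <;> simp [hA, hB, hw a]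

lemma mass_biUnion_le (hw : ∀ a, 0 ≤ w a) {κ : Type*} (s : Finset κ) (A : κ → Set α) :
    mass w {a | ∃ c ∈ s, a ∈ A c} ≤ ∑ c ∈ s, mass w (A c) := by
  unfold mass
  rw [Finset.sum_comm]
  refine Finset.sum_le_sum fun a _ => ?_
  by_cases h : a ∈ {a | ∃ c ∈ s, a ∈ A c}
  · obtain ⟨c, hc, hac⟩ := id h
    rw [Set.indicator_of_mem h]
    calc w a = (A c).indicator w a := (Set.indicator_of_mem hac w).symm
      _ ≤ _ := Finset.single_le_sum (f := fun c => (A c).indicator w a)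
          (fun c _ => Set.indicator_nonneg (fun a _ => hw a) a) hc
  · rw [Set.indicator_of_notMem h]
    exact Finset.sum_nonneg fun c _ => Set.indicator_nonneg (fun a _ => hw a) a

/-- Markov's inequality. -/
lemma mass_le_sum (hw : ∀ a, 0 ≤ w a) {A : Set α} {f : α → ℝ} (hf : ∀ a, 0 ≤ f a)
    (h : ∀ a ∈ A, 1 ≤ f a) : mass w A ≤ ∑ a, w a * f a := by
  refine Finset.sum_le_sum fun a _ => ?_
  by_cases ha : a ∈ A
  · rw [Set.indicator_of_mem ha]
    exact le_mul_of_one_le_right (hw a) (h a ha)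
  · rw [Set.indicator_of_notMem ha]
    exact mul_nonneg (hw a) (hf a)

/-- The expectation of a product of functions of independent coordinates factorizes. -/
lemma sum_prodWeight_mul_prod [DecidableEq ι] (w : α → ℝ) (g : ι → α → ℝ) :
    ∑ x : ι → α, prodWeight w x * ∏ i, g i (x i) = ∏ i, ∑ a, w a * g i a := by
  rw [Finset.prod_univ_sum, Fintype.piFinset_univ]
  exact Finset.sum_congr rfl fun x _ => Finset.prod_mul_distrib.symm

lemma sum_prodWeight [DecidableEq ι] (hw : ∑ a, w a = 1) : ∑ x : ι → α, prodWeight w x = 1 := by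
  have h := sum_prodWeight_mul_prod (ι := ι) w (fun _ _ => 1)
  simpa [hw] using h

/-- Resampling a coordinate: a function of `x i` and of the remaining coordinates has the same
expectation when `x i` is replaced by an independent copy. -/
lemma sum_prodWeight_resample [DecidableEq ι] (hw : ∑ a, w a = 1) (i : ι) (a₀ : α)
    (f : α → (ι → α) → ℝ) :
    ∑ x : ι → α, prodWeight w x * f (x i) (Function.update x i a₀) =
      ∑ x : ι → α, prodWeight w x * ∑ a, w a * f a (Function.update x i a₀) := by
  -- Exchanging the `i`-th coordinate with the fresh copy preserves the joint weight.
  let e : (ι → α) × α ≃ (ι → α) × α :=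
    { toFun := fun y => (Function.update y.1 i y.2, y.1 i)
      invFun := fun y => (Function.update y.1 i y.2, y.1 i)
      left_inv := fun y => by simp
      right_inv := fun y => by simp }
  have hupd : ∀ (x : ι → α) (a : α),
      prodWeight w (Function.update x i a) * w (x i) = prodWeight w x * w a := by
    intro x a
    unfold prodWeight
    rw [← Finset.mul_prod_erase Finset.univ (fun j => w (x j)) (Finset.mem_univ i),
      ← Finset.mul_prod_erase Finset.univ (fun j => w (Function.update x i a j))
        (Finset.mem_univ i)]
    have : ∏ j ∈ Finset.univ.erase i, w (Function.update x i a j) =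
        ∏ j ∈ Finset.univ.erase i, w (x j) :=
      Finset.prod_congr rfl fun j hj => by
        rw [Function.update_of_ne (Finset.ne_of_mem_erase hj)]
    rw [this, Function.update_self]
    ring
  have h1 : ∑ x : ι → α, prodWeight w x * f (x i) (Function.update x i a₀) =
      ∑ y : (ι → α) × α, prodWeight w y.1 * w y.2 * f (y.1 i) (Function.update y.1 i a₀) := by
    rw [Fintype.sum_prod_type]
    refine Finset.sum_congr rfl fun x _ => ?_
    simp only []
    rw [← Finset.sum_mul, ← Finset.mul_sum, hw, mul_one]
  rw [h1, Fintype.sum_equiv e _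
    (fun y => prodWeight w y.1 * w y.2 * f y.2 (Function.update y.1 i a₀)),
    Fintype.sum_prod_type]
  · refine Finset.sum_congr rfl fun x _ => ?_
    rw [Finset.mul_sum]
    exact Finset.sum_congr rfl fun a _ => by ring
  · intro y
    simp only [e, Equiv.coe_fn_mk, Function.update_idem, hupd]

end mass

/-! ### The tracing attack -/

lemma prob_eq_mass {Ω : Type*} [Fintype Ω] (P : PMF Ω) (S : Set Ω) :
    prob P S = mass (fun t => (P t).toReal) S := by
  unfold prob mass
  rw [PMF.toOuterMeasure_apply, tsum_fintype, ENNReal.toReal_sum]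
  · refine Finset.sum_congr rfl fun t _ => ?_
    by_cases h : t ∈ S <;> simp [h]
  · intro t _
    by_cases h : t ∈ S <;> simp [h, P.apply_ne_top]

lemma sum_toReal_eq_one {Ω : Type*} [Fintype Ω] (P : PMF Ω) : ∑ t, (P t).toReal = 1 := by
  rw [← ENNReal.toReal_sum fun t _ => P.apply_ne_top t, ← tsum_fintype (L := .unconditional _),
    P.tsum_coe, ENNReal.toReal_one]

/-- Differential privacy bounds the correlation of the output with a single row: if each fixed
output `T` passes the test `A T` on a random row with probability at most `ρ`, then the output of
`M` passes the test on the `i`-th row of its own input with probability at most `e ^ ε * ρ + δ`. -/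
lemma sum_mul_prob_test_le {n d : ℕ} {ε δ ρ : ℝ} {M : Mechanism n d}
    (hM : IsDifferentiallyPrivate ε δ M) {w : (Fin d → ℤˣ) → ℝ} (hw : ∀ r, 0 ≤ w r)
    (hw1 : ∑ r, w r = 1) (A : (Fin d → Bool) → Set (Fin d → ℤˣ))
    (hρ : ∀ T, mass w (A T) ≤ ρ) (i : Fin n) :
    ∑ X : Dataset n d, prodWeight w X * prob (M X) {T | X i ∈ A T} ≤ Real.exp ε * ρ + δ := by
  have hW : ∀ X : Dataset n d, 0 ≤ prodWeight w X := prodWeight_nonneg hw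
  have hW1 : ∑ X : Dataset n d, prodWeight w X = 1 := sum_prodWeight hw1
  have hstep : ∀ X : Dataset n d, ∑ r, w r * prob (M X) {T | r ∈ A T} ≤ ρ := by
    intro X
    calc ∑ r, w r * prob (M X) {T | r ∈ A T}
        = ∑ T, (M X T).toReal * mass w (A T) := by
          simp only [prob_eq_mass, mass, Finset.mul_sum]
          rw [Finset.sum_comm]
          refine Finset.sum_congr rfl fun T _ => Finset.sum_congr rfl fun r _ => ?_
          by_cases h : r ∈ A T <;> simp [h, mul_comm]
      _ ≤ ∑ T, (M X T).toReal * ρ :=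
          Finset.sum_le_sum fun T _ => mul_le_mul_of_nonneg_left (hρ T) ENNReal.toReal_nonneg
      _ = ρ := by rw [← Finset.sum_mul, sum_toReal_eq_one, one_mul]
  calc ∑ X : Dataset n d, prodWeight w X * prob (M X) {T | X i ∈ A T}
      ≤ ∑ X : Dataset n d, prodWeight w X *
          (Real.exp ε * prob (M (Function.update X i 1)) {T | X i ∈ A T} + δ) := by
        refine Finset.sum_le_sum fun X _ => mul_le_mul_of_nonneg_left ?_ (hW X)
        refine hM X _ ⟨i, fun i' hi' => ?_⟩ _
        rw [Function.update_of_ne hi']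
    _ = Real.exp ε * ∑ X : Dataset n d, prodWeight w X *
          prob (M (Function.update X i 1)) {T | X i ∈ A T} + δ := by
        simp only [mul_add, Finset.sum_add_distrib, ← Finset.sum_mul, hW1, one_mul]
        rw [Finset.mul_sum]
        congr 1
        exact Finset.sum_congr rfl fun X _ => by ring
    _ ≤ Real.exp ε * ρ + δ := by
        gcongr
        rw [sum_prodWeight_resample hw1 i 1 (fun r X' => prob (M X') {T | r ∈ A T})]
        calc _ ≤ ∑ X : Dataset n d, prodWeight w X * ρ :=
              Finset.sum_le_sum fun X _ => mul_le_mul_of_nonneg_left (hstep _) (hW X)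
          _ = ρ := by rw [← Finset.sum_mul, hW1, one_mul]

open Classical in
/-- The tracing attack. If the test `A T` rarely accepts a fresh row, whereas for most random
datasets `X` every accurate output `T` is such that `A T` accepts most rows of `X`, then no private
mechanism is accurate. -/
theorem not_exists_mechanism_of_test {n d k : ℕ} (hn : 0 < n) {ε δ β α b g ρ : ℝ}
    {w : (Fin d → ℤˣ) → ℝ} (hw : ∀ r, 0 ≤ w r) (hw1 : ∑ r, w r = 1)
    (A : (Fin d → Bool) → Set (Fin d → ℤˣ)) (hρ : ∀ T, mass w (A T) ≤ ρ)
    (hβ0 : 0 ≤ β) (hβ1 : β ≤ 1) (hb0 : 0 ≤ b) (hb1 : b ≤ 1) (hg0 : 0 ≤ g)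
    (hgood : mass (prodWeight w) {X : Dataset n d | ∃ T, IsAccurateTopK k α X T ∧
      ((Finset.univ.filter fun i => X i ∈ A T).card : ℝ) < (1 - b) * n} ≤ g)
    (hlt : b + g + Real.exp ε * ρ < 1 - β - δ) :
    ¬ ∃ M : Mechanism n d, IsDifferentiallyPrivate ε δ M ∧ SolvesTopK k α β M := by
  rintro ⟨M, hM, hS⟩
  set bad : Set (Dataset n d) := {X : Dataset n d | ∃ T, IsAccurateTopK k α X T ∧
      ((Finset.univ.filter fun i => X i ∈ A T).card : ℝ) < (1 - b) * n} with hbad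
  have hW : ∀ X : Dataset n d, 0 ≤ prodWeight w X := prodWeight_nonneg hw
  have hW1 : ∑ X : Dataset n d, prodWeight w X = 1 := sum_prodWeight hw1
  have hn' : (0 : ℝ) < n := by exact_mod_cast hn
  have hupper : ∑ i : Fin n, ∑ X : Dataset n d, prodWeight w X * prob (M X) {T | X i ∈ A T} ≤
      n * (Real.exp ε * ρ + δ) := by
    calc _ ≤ ∑ _i : Fin n, (Real.exp ε * ρ + δ) :=
          Finset.sum_le_sum fun i _ => sum_mul_prob_test_le hM hw hw1 A hρ i
      _ = _ := by rw [Finset.sum_const, Finset.card_univ, Fintype.card_fin, nsmul_eq_mul]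
  have hcount : ∀ X : Dataset n d, ∑ i : Fin n, prob (M X) {T | X i ∈ A T} =
      ∑ T, (M X T).toReal * ((Finset.univ.filter fun i => X i ∈ A T).card : ℝ) := by
    intro X
    simp only [prob_eq_mass, mass]
    rw [Finset.sum_comm]
    refine Finset.sum_congr rfl fun T _ => ?_
    rw [Finset.card_filter, Nat.cast_sum, Finset.mul_sum]
    refine Finset.sum_congr rfl fun i _ => ?_
    by_cases h : X i ∈ A T <;> simp [h]
  have hX : ∀ X : Dataset n d, X ∉ bad →
      (1 - b) * n * (1 - β) ≤ ∑ i : Fin n, prob (M X) {T | X i ∈ A T} := by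
    intro X hXb
    rw [hcount]
    calc (1 - b) * n * (1 - β)
        ≤ (1 - b) * n * prob (M X) {t | IsAccurateTopK k α X t} :=
          mul_le_mul_of_nonneg_left (hS X) (mul_nonneg (by linarith) hn'.le)
      _ ≤ _ := by
          rw [prob_eq_mass, mass, Finset.mul_sum]
          refine Finset.sum_le_sum fun T _ => ?_
          by_cases hT : T ∈ {t | IsAccurateTopK k α X t}
          · rw [Set.indicator_of_mem hT, mul_comm]
            refine mul_le_mul_of_nonneg_left ?_ ENNReal.toReal_nonneg
            by_contra hcon
            exact hXb ⟨T, hT, not_le.mp hcon⟩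
          · rw [Set.indicator_of_notMem hT, mul_zero]
            exact mul_nonneg ENNReal.toReal_nonneg (Nat.cast_nonneg _)
  have hlower : (1 - b) * n * (1 - β) * (1 - g) ≤
      ∑ i : Fin n, ∑ X : Dataset n d, prodWeight w X * prob (M X) {T | X i ∈ A T} := by
    rw [Finset.sum_comm]
    have hc0 : 0 ≤ (1 - b) * n * (1 - β) :=
      mul_nonneg (mul_nonneg (by linarith) hn'.le) (by linarith)
    have hmass : 1 - g ≤ mass (prodWeight w) badᶜ := by
      have := mass_add_mass_compl (w := prodWeight w) bad
      rw [hW1] at this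
      linarith
    refine (mul_le_mul_of_nonneg_left hmass hc0).trans ?_
    rw [mass, Finset.mul_sum]
    refine Finset.sum_le_sum fun X _ => ?_
    rw [← Finset.mul_sum]
    by_cases hXb : X ∈ bad
    · rw [Set.indicator_of_notMem (by simpa using hXb), mul_zero]
      refine mul_nonneg (hW X) (Finset.sum_nonneg fun i _ => ?_)
      exact ENNReal.toReal_nonneg
    · rw [Set.indicator_of_mem (by simpa using hXb), mul_comm]
      exact mul_le_mul_of_nonneg_left (hX X hXb) (hW X)
  have hkey : n * ((1 - b) * (1 - β) * (1 - g)) ≤ n * (Real.exp ε * ρ + δ) := by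
    calc _ = (1 - b) * n * (1 - β) * (1 - g) := by ring
      _ ≤ _ := hlower.trans hupper
  have hfin := le_of_mul_le_mul_left hkey hn'
  have h1 : 1 - b - β ≤ (1 - b) * (1 - β) := by nlinarith
  have h2 : (1 - b) * (1 - β) ≤ 1 := by nlinarith
  have h3 : 0 ≤ (1 - b) * (1 - β) := mul_nonneg (by linarith) (by linarith)
  nlinarith

/-! ### Tail bounds -/

section tails

variable {α ι : Type*} [Fintype α] [Fintype ι] [DecidableEq ι] {w : α → ℝ}

lemma sum_prodWeight_mul_exp_le (hw : ∀ a, 0 ≤ w a) (hw1 : ∑ a, w a = 1) {f : α → ℝ} {θ v : ℝ}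
    (h : ∑ a, w a * Real.exp (θ * f a) ≤ Real.exp v) (I : Finset ι) :
    ∑ x : ι → α, prodWeight w x * Real.exp (θ * ∑ i ∈ I, f (x i)) ≤ Real.exp (I.card * v) := by
  have h1 : ∀ x : ι → α, Real.exp (θ * ∑ i ∈ I, f (x i)) =
      ∏ i, if i ∈ I then Real.exp (θ * f (x i)) else 1 := by
    intro x
    rw [Finset.prod_ite_mem, Finset.univ_inter, Finset.mul_sum, Real.exp_sum]
  simp only [h1]
  rw [sum_prodWeight_mul_prod w fun i a => if i ∈ I then Real.exp (θ * f a) else 1]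
  have h2 : ∀ i, ∑ a, w a * (if i ∈ I then Real.exp (θ * f a) else 1) =
      if i ∈ I then ∑ a, w a * Real.exp (θ * f a) else 1 := by
    intro i
    split_ifs
    · rfl
    · simpa using hw1
  simp only [h2]
  rw [Finset.prod_ite_mem, Finset.univ_inter, Finset.prod_const, Real.exp_nat_mul]
  exact pow_le_pow_left₀
    (Finset.sum_nonneg fun a _ => mul_nonneg (hw a) (Real.exp_pos _).le) h _

/-- Chernoff's bound for a sum of independent variables. -/
lemma mass_le_sum_le_exp (hw : ∀ a, 0 ≤ w a) (hw1 : ∑ a, w a = 1) {f : α → ℝ} {θ v : ℝ}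
    (hθ : 0 ≤ θ) (h : ∑ a, w a * Real.exp (θ * f a) ≤ Real.exp v) (I : Finset ι) (s : ℝ) :
    mass (prodWeight w) {x : ι → α | s ≤ ∑ i ∈ I, f (x i)} ≤ Real.exp (I.card * v - θ * s) := by
  refine (mass_le_sum (prodWeight_nonneg hw)
    (f := fun x : ι → α => Real.exp (-(θ * s)) * Real.exp (θ * ∑ i ∈ I, f (x i)))
    (fun x => by positivity) fun x hx => ?_).trans ?_
  · rw [← Real.exp_add]
    refine Real.one_le_exp ?_
    have := mul_le_mul_of_nonneg_left (show s ≤ ∑ i ∈ I, f (x i) from hx) hθ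
    linarith
  · calc _ = Real.exp (-(θ * s)) *
          ∑ x : ι → α, prodWeight w x * Real.exp (θ * ∑ i ∈ I, f (x i)) := by
          rw [Finset.mul_sum]
          exact Finset.sum_congr rfl fun x _ => by ring
      _ ≤ Real.exp (-(θ * s)) * Real.exp (I.card * v) :=
          mul_le_mul_of_nonneg_left (sum_prodWeight_mul_exp_le hw hw1 h I) (Real.exp_pos _).le
      _ = _ := by rw [← Real.exp_add]; congr 1; ring

end tails

/-- The uniform distribution on `{±1}`. -/
abbrev uniformSign : ℤˣ → ℝ := signWeight (1 / 2)

lemma uniformSign_nonneg (u : ℤˣ) : 0 ≤ uniformSign u :=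
  signWeight_nonneg (by norm_num) (by norm_num) u

lemma sum_uniformSign_mul_exp_le (θ : ℝ) :
    ∑ u, uniformSign u * Real.exp (θ * ((u : ℤ) : ℝ)) ≤ Real.exp (θ ^ 2 / 2) := by
  refine le_trans (le_of_eq ?_) (Real.cosh_le_exp_half_sq θ)
  simp only [uniformSign]
  rw [sum_units, signWeight_one, signWeight_neg_one, Real.cosh_eq]
  push_cast
  ring_nf

/-- A partial sum of one uniformly random row is subgaussian. -/
lemma mass_row_sum_le {d : ℕ} {θ : ℝ} (hθ : 0 ≤ θ) (J : Finset (Fin d)) (s : ℝ) :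
    mass (prodWeight uniformSign) {r : Fin d → ℤˣ | s ≤ ∑ j ∈ J, ((r j : ℤ) : ℝ)} ≤
      Real.exp (J.card * (θ ^ 2 / 2) - θ * s) :=
  mass_le_sum_le_exp (f := fun u : ℤˣ => ((u : ℤ) : ℝ)) uniformSign_nonneg (sum_signWeight _) hθ
    (sum_uniformSign_mul_exp_le θ) J s

/-- The sum over a combinatorial rectangle of a uniformly random dataset is subgaussian. -/
lemma mass_rectangle_sum_le {n d : ℕ} {θ : ℝ} (hθ : 0 ≤ θ) (I : Finset (Fin n))
    (J : Finset (Fin d)) (s : ℝ) :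
    mass (prodWeight (prodWeight uniformSign))
        {X : Dataset n d | s ≤ ∑ i ∈ I, ∑ j ∈ J, ((X i j : ℤ) : ℝ)} ≤
      Real.exp (I.card * (J.card * (θ ^ 2 / 2)) - θ * s) :=
  mass_le_sum_le_exp (f := fun r : Fin d → ℤˣ => ∑ j ∈ J, ((r j : ℤ) : ℝ))
    (prodWeight_nonneg uniformSign_nonneg) (sum_prodWeight (sum_signWeight _)) hθ
    (sum_prodWeight_mul_exp_le (f := fun u : ℤˣ => ((u : ℤ) : ℝ)) uniformSign_nonneg
      (sum_signWeight _) (sum_uniformSign_mul_exp_le θ) J) I s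

open Classical in
/-- If a random column lies in `A` with probability at least `q`, then a random dataset with `d`
independent columns is unlikely to have fewer than `k` columns in `A`. -/
lemma mass_card_columns_lt_le {n d : ℕ} {p q : ℝ} (h0 : 0 ≤ p) (h1 : p ≤ 1)
    (A : Set (Fin n → ℤˣ)) (hq : q ≤ mass (prodWeight (signWeight p)) A) (k : ℕ) :
    mass (prodWeight (prodWeight (signWeight p)))
        {X : Dataset n d | (Finset.univ.filter fun j => (fun i => X i j) ∈ A).card < k} ≤
      Real.exp (k - d * q / 2) := by
  set w := signWeight p
  have hw : ∀ u, 0 ≤ w u := signWeight_nonneg h0 h1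
  have hw1 : ∑ u, w u = 1 := sum_signWeight p
  let h : (Fin n → ℤˣ) → ℝ := fun y => if y ∈ A then 1 / 2 else 1
  have hprod : ∀ X : Dataset n d, ∏ j, h (fun i => X i j) =
      (1 / 2 : ℝ) ^ (Finset.univ.filter fun j => (fun i => X i j) ∈ A).card := by
    intro X
    rw [Finset.prod_ite, Finset.prod_const, Finset.prod_const_one, mul_one]
  -- Markov's inequality for `2 ^ (k - N)`, where `N` is the number of columns in `A`.
  refine (mass_le_sum (prodWeight_nonneg (prodWeight_nonneg hw))
    (f := fun X : Dataset n d => (2 : ℝ) ^ k * ∏ j, h (fun i => X i j))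
    (fun X => by rw [hprod]; positivity) fun X hX => ?_).trans ?_
  · rw [hprod, one_div, inv_pow, ← div_eq_mul_inv, one_le_div (by positivity)]
    exact pow_le_pow_right₀ (by norm_num) (le_of_lt hX)
  have hone : ∑ y : Fin n → ℤˣ, prodWeight w y * h y = 1 - mass (prodWeight w) A / 2 := by
    rw [← sum_prodWeight (ι := Fin n) hw1, mass, Finset.sum_div, ← Finset.sum_sub_distrib]
    refine Finset.sum_congr rfl fun y _ => ?_
    by_cases hy : y ∈ A <;> simp [h, hy]
    ring
  -- Transposing the dataset turns independent rows into independent columns.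
  have hflip : ∑ X : Dataset n d, prodWeight (prodWeight w) X * ∏ j, h (fun i => X i j) =
      ∑ Y : Fin d → Fin n → ℤˣ, prodWeight (prodWeight w) Y * ∏ j, h (Y j) := by
    refine Fintype.sum_equiv (Equiv.piComm fun _ _ => ℤˣ) _ _ fun X => ?_
    congr 1
    unfold prodWeight
    exact Finset.prod_comm
  calc ∑ X : Dataset n d, prodWeight (prodWeight w) X * ((2 : ℝ) ^ k * ∏ j, h (fun i => X i j))
      = 2 ^ k * ∑ X : Dataset n d, prodWeight (prodWeight w) X * ∏ j, h (fun i => X i j) := by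
        rw [Finset.mul_sum]
        exact Finset.sum_congr rfl fun X _ => by ring
    _ = 2 ^ k * (1 - mass (prodWeight w) A / 2) ^ d := by
        rw [hflip, sum_prodWeight_mul_prod (prodWeight w) fun _ => h]
        simp [hone]
    _ ≤ Real.exp 1 ^ k * Real.exp (-(q / 2)) ^ d := by
        have hm : mass (prodWeight w) A ≤ 1 := by
          have := mass_add_mass_compl (w := prodWeight w) A
          rw [sum_prodWeight hw1] at this
          have h2 : 0 ≤ mass (prodWeight w) Aᶜ :=
            Finset.sum_nonneg fun y _ => Set.indicator_nonneg (fun y _ => prodWeight_nonneg hw y) y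
          linarith
        have he : (2 : ℝ) ≤ Real.exp 1 := by linarith [Real.add_one_le_exp (1 : ℝ)]
        have hq' : 1 - mass (prodWeight w) A / 2 ≤ Real.exp (-(q / 2)) := by
          linarith [Real.add_one_le_exp (-(q / 2))]
        exact mul_le_mul (pow_le_pow_left₀ (by norm_num) he k)
          (pow_le_pow_left₀ (by linarith) hq' d) (pow_nonneg (by linarith) d) (by positivity)
    _ = Real.exp (k - d * q / 2) := by
        rw [← Real.exp_nat_mul, ← Real.exp_nat_mul, ← Real.exp_add]
        congr 1
        ring

/-! ### A lower bound for the binomial tail -/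

lemma one_add_le_exp_sub_sq_add_cube {γ y : ℝ} (hγ : γ ≤ 1 / 2) (hy : |y| = γ) :
    1 + y ≤ Real.exp (y - γ ^ 2 / 2 + 2 * γ ^ 3) := by
  have hlt : |-y| < 1 := by rw [abs_neg, hy]; linarith
  have hpos : 0 < 1 + y := by linarith [neg_abs_le y]
  have h := Real.abs_log_sub_add_sum_range_le hlt 2
  have hγ0 : 0 ≤ γ := hy ▸ abs_nonneg y
  rw [abs_neg, hy, Finset.sum_range_succ, Finset.sum_range_one] at h
  have hsq : y ^ 2 = γ ^ 2 := by rw [← hy, sq_abs]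
  have h2 := (abs_le.mp h).2
  have hb : γ ^ 3 / (1 - γ) ≤ 2 * γ ^ 3 := by
    rw [div_le_iff₀ (by linarith)]
    nlinarith [pow_nonneg hγ0 3]
  rw [← Real.exp_log hpos]
  refine Real.exp_le_exp.mpr ?_
  norm_num at h2
  have : Real.log (1 - -y) = Real.log (1 + y) := by ring_nf
  nlinarith

lemma sum_signWeight_mul_exp_le {γ t : ℝ} (hγ : |γ| ≤ 1) (ht : |t| ≤ 1 / 2) :
    ∑ u, signWeight ((1 + γ) / 2) u * Real.exp (t * (((u : ℤ) : ℝ) - γ)) ≤ Real.exp (t ^ 2) := by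
  obtain ⟨hγ1, hγ2⟩ := abs_le.mp hγ
  have hexp : ∀ y : ℝ, |y| ≤ 2 → Real.exp (t * y) ≤ 1 + t * y + (t * y) ^ 2 := by
    intro y hy
    have : |t * y| ≤ 1 := by
      rw [abs_mul]
      nlinarith [abs_nonneg t, abs_nonneg y]
    linarith [(abs_le.mp (Real.abs_exp_sub_one_sub_id_le this)).2]
  have h1 := hexp (1 - γ) (abs_le.mpr ⟨by linarith, by linarith⟩)
  have h2 := hexp (-1 - γ) (abs_le.mpr ⟨by linarith, by linarith⟩)
  rw [sum_units, signWeight_one, signWeight_neg_one]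
  push_cast
  calc _ ≤ (1 + γ) / 2 * (1 + t * (1 - γ) + (t * (1 - γ)) ^ 2) +
        (1 - (1 + γ) / 2) * (1 + t * (-1 - γ) + (t * (-1 - γ)) ^ 2) :=
        add_le_add (mul_le_mul_of_nonneg_left h1 (by linarith))
          (mul_le_mul_of_nonneg_left h2 (by linarith))
    _ = 1 + t ^ 2 - (t * γ) ^ 2 := by ring
    _ ≤ t ^ 2 + 1 := by nlinarith [sq_nonneg (t * γ)]
    _ ≤ Real.exp (t ^ 2) := Real.add_one_le_exp _

/-- A sum of `n` signs of mean `γ` is likely to be within `3 √n` of its mean. -/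
lemma half_le_mass_signWeight {n : ℕ} (hn : 4 ≤ n) {γ : ℝ} (hγ : |γ| ≤ 1) :
    1 / 2 ≤ mass (prodWeight (signWeight ((1 + γ) / 2)))
      {x : Fin n → ℤˣ | |∑ i, ((x i : ℤ) : ℝ) - n * γ| < 3 * √n} := by
  obtain ⟨hγ1, hγ2⟩ := abs_le.mp hγ
  set w := signWeight ((1 + γ) / 2)
  have hw : ∀ u, 0 ≤ w u := signWeight_nonneg (by linarith) (by linarith)
  have hw1 : ∑ u, w u = 1 := sum_signWeight _
  have hsq : (2 : ℝ) ≤ √n := by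
    rw [Real.le_sqrt (by norm_num) (Nat.cast_nonneg n)]
    have : (4 : ℝ) ≤ n := by exact_mod_cast hn
    linarith
  have hss : √(n : ℝ) ^ 2 = n := Real.sq_sqrt (Nat.cast_nonneg n)
  set t : ℝ := 1 / √n with ht
  have ht0 : 0 ≤ t := by positivity
  have htn : t * √n = 1 := by rw [ht]; field_simp
  have ht1 : |t| ≤ 1 / 2 := by
    rw [abs_of_nonneg ht0]
    nlinarith
  have htt : n * t ^ 2 = 1 := by
    calc n * t ^ 2 = (t * √n) ^ 2 := by rw [mul_pow, hss]; ring
      _ = 1 := by rw [htn]; ring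
  have hsum : ∀ x : Fin n → ℤˣ, ∑ i, (((x i : ℤ) : ℝ) - γ) = ∑ i, ((x i : ℤ) : ℝ) - n * γ := by
    intro x
    simp [Finset.sum_sub_distrib]
  have hup := mass_le_sum_le_exp (ι := Fin n) (f := fun u : ℤˣ => ((u : ℤ) : ℝ) - γ) hw hw1 ht0
    (sum_signWeight_mul_exp_le hγ ht1) Finset.univ (3 * √n)
  have hlo := mass_le_sum_le_exp (ι := Fin n) (f := fun u : ℤˣ => -(((u : ℤ) : ℝ) - γ)) hw hw1 ht0
    (v := t ^ 2) (by
      have := sum_signWeight_mul_exp_le hγ (t := -t) (by rwa [abs_neg])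
      rw [neg_sq] at this
      refine le_trans (le_of_eq (Finset.sum_congr rfl fun u _ => ?_)) this
      rw [mul_neg, neg_mul]) Finset.univ (3 * √n)
  have hval : (Finset.univ : Finset (Fin n)).card * t ^ 2 - t * (3 * √n) = -2 := by
    rw [Finset.card_univ, Fintype.card_fin, htt]
    linarith
  rw [hval] at hup hlo
  have he : Real.exp (-2) ≤ 1 / 4 := by
    have h2 : (2 : ℝ) ≤ Real.exp 1 := by linarith [Real.add_one_le_exp (1 : ℝ)]
    have h4 : Real.exp 2 = Real.exp 1 * Real.exp 1 := by rw [← Real.exp_add]; norm_num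
    rw [Real.exp_neg, inv_le_comm₀ (Real.exp_pos _) (by norm_num), h4]
    nlinarith
  set G : Set (Fin n → ℤˣ) := {x | |∑ i, ((x i : ℤ) : ℝ) - n * γ| < 3 * √n}
  have hcover : Gᶜ ⊆ {x : Fin n → ℤˣ | 3 * √n ≤ ∑ i, (((x i : ℤ) : ℝ) - γ)} ∪
      {x : Fin n → ℤˣ | 3 * √n ≤ ∑ i, -(((x i : ℤ) : ℝ) - γ)} := by
    intro x hx
    have hx' : 3 * √n ≤ |∑ i, ((x i : ℤ) : ℝ) - n * γ| := not_lt.mp hx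
    rw [Set.mem_union, Set.mem_ofPred_eq, Set.mem_ofPred_eq, Finset.sum_neg_distrib, hsum]
    exact le_abs.mp hx'
  have h1 := mass_add_mass_compl (w := prodWeight w) G
  rw [sum_prodWeight hw1] at h1
  have h2 := (mass_mono (prodWeight_nonneg hw) hcover).trans
    (mass_union_le (prodWeight_nonneg hw) _ _)
  linarith

/-- The lower tail bound matching Chernoff's inequality to leading order, obtained by comparing
uniform signs with signs of mean `γ`. -/
lemma exp_le_mass_uniformSign {n : ℕ} (hn : 4 ≤ n) {γ : ℝ} (hγ0 : 0 ≤ γ) (hγ : γ ≤ 1 / 2) :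
    1 / 2 * Real.exp (-(n * γ ^ 2 / 2 + 3 * γ * √n + 2 * n * γ ^ 3)) ≤
      mass (prodWeight uniformSign)
        {x : Fin n → ℤˣ | n * γ - 3 * √n ≤ ∑ i, ((x i : ℤ) : ℝ)} := by
  set E : ℝ := n * γ ^ 2 / 2 + 3 * γ * √n + 2 * n * γ ^ 3 with hE
  set w := signWeight ((1 + γ) / 2)
  set G : Set (Fin n → ℤˣ) := {x | |∑ i, ((x i : ℤ) : ℝ) - n * γ| < 3 * √n}
  have habs : |γ| ≤ 1 := by rw [abs_of_nonneg hγ0]; linarith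
  have hw : ∀ u, 0 ≤ w u := signWeight_nonneg (by linarith) (by linarith)
  have hU : ∀ x : Fin n → ℤˣ, 0 ≤ prodWeight uniformSign x := prodWeight_nonneg uniformSign_nonneg
  have hcoord : ∀ u : ℤˣ, w u ≤
      uniformSign u * Real.exp (γ * ((u : ℤ) : ℝ) - γ ^ 2 / 2 + 2 * γ ^ 3) := by
    intro u
    rcases Int.units_eq_one_or u with rfl | rfl
    · have := one_add_le_exp_sub_sq_add_cube (y := γ) hγ (abs_of_nonneg hγ0)
      simp only [w, signWeight_one]
      push_cast
      rw [mul_one]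
      linarith
    · have := one_add_le_exp_sub_sq_add_cube (y := -γ) hγ (by rw [abs_neg, abs_of_nonneg hγ0])
      simp only [w, signWeight_neg_one]
      push_cast
      rw [mul_neg_one]
      linarith
  -- On `G` the density of the biased distribution is at most `exp E`.
  have hratio : ∀ x ∈ G, prodWeight w x ≤ prodWeight uniformSign x * Real.exp E := by
    intro x hx
    have h1 : prodWeight w x ≤ prodWeight uniformSign x *
        Real.exp (∑ i, (γ * ((x i : ℤ) : ℝ) - γ ^ 2 / 2 + 2 * γ ^ 3)) := by
      unfold prodWeight
      rw [Real.exp_sum, ← Finset.prod_mul_distrib]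
      exact Finset.prod_le_prod (fun i _ => hw _) fun i _ => hcoord _
    refine h1.trans (mul_le_mul_of_nonneg_left (Real.exp_le_exp.mpr ?_) (hU x))
    have h2 : ∑ i, (γ * ((x i : ℤ) : ℝ) - γ ^ 2 / 2 + 2 * γ ^ 3) =
        γ * ∑ i, ((x i : ℤ) : ℝ) + n * (-(γ ^ 2 / 2) + 2 * γ ^ 3) := by
      rw [Finset.mul_sum]
      simp only [sub_eq_add_neg, Finset.sum_add_distrib, Finset.sum_const, Finset.card_univ,
        Fintype.card_fin, nsmul_eq_mul]
      ring
    rw [h2, hE]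
    have h3 := (abs_lt.mp (show |∑ i, ((x i : ℤ) : ℝ) - n * γ| < 3 * √n from hx)).2
    have h4 := mul_le_mul_of_nonneg_left h3.le hγ0
    nlinarith
  have hmass : mass (prodWeight w) G ≤ mass (prodWeight uniformSign) G * Real.exp E := by
    unfold mass
    rw [Finset.sum_mul]
    refine Finset.sum_le_sum fun x _ => ?_
    by_cases hx : x ∈ G
    · simpa only [Set.indicator_of_mem hx] using hratio x hx
    · simp [Set.indicator_of_notMem hx]
  have hhalf := (half_le_mass_signWeight hn habs).trans hmass
  have hsub : G ⊆ {x : Fin n → ℤˣ | n * γ - 3 * √n ≤ ∑ i, ((x i : ℤ) : ℝ)} := by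
    intro x hx
    have h3 := (abs_lt.mp (show |∑ i, ((x i : ℤ) : ℝ) - n * γ| < 3 * √n from hx)).1
    rw [Set.mem_ofPred_eq]
    linarith
  refine le_trans ?_ (mass_mono hU hsub)
  rw [Real.exp_neg, ← div_eq_mul_inv, div_le_iff₀ (Real.exp_pos _)]
  exact hhalf

/-! ### Accurate outputs select columns with large sums -/

lemma le_kthLargest {d k : ℕ} (hk : 1 ≤ k) (q : Fin d → ℝ) {s : ℝ}
    (h : k ≤ (Finset.univ.filter fun j => s ≤ q j).card) : s ≤ kthLargest k q := by
  refine le_csSup ⟨∑ j, |q j|, fun τ hτ => ?_⟩ h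
  obtain ⟨j, hj⟩ := Finset.card_pos.mp (lt_of_lt_of_le hk hτ)
  calc τ ≤ q j := (Finset.mem_filter.mp hj).2
    _ ≤ |q j| := le_abs_self _
    _ ≤ _ := Finset.single_le_sum (f := fun j => |q j|) (fun j _ => abs_nonneg _)
        (Finset.mem_univ j)

/-- If `k` columns have sum at least `s`, then every column selected by an `α`-accurate output has
sum at least `s - α * n`. -/
lemma IsAccurateTopK.le_column_sum {n d k : ℕ} (hn : 0 < n) (hk : 1 ≤ k) {α s : ℝ}
    {X : Dataset n d} {T : Fin d → Bool} (hT : IsAccurateTopK k α X T)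
    (hs : k ≤ (Finset.univ.filter fun j => s ≤ ∑ i, ((X i j : ℤ) : ℝ)).card) {j : Fin d}
    (hj : T j = true) : s - α * n ≤ ∑ i, ((X i j : ℤ) : ℝ) := by
  have hn' : (0 : ℝ) < n := by exact_mod_cast hn
  have hm : ∀ j, marginal X j = (∑ i, ((X i j : ℤ) : ℝ)) / n := fun j => by
    rw [marginal]; ring
  have h1 : s / n ≤ kthLargest k (marginal X) := by
    refine le_kthLargest hk _ (hs.trans (Finset.card_le_card fun j hj => ?_))
    rw [Finset.mem_filter] at hj ⊢
    refine ⟨hj.1, ?_⟩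
    rw [hm]
    exact div_le_div_of_nonneg_right hj.2 hn'.le
  have h2 := hT.2 j hj
  rw [hm, le_div_iff₀ hn'] at h2
  have h3 : s / n * n = s := div_mul_cancel₀ s hn'.ne'
  nlinarith

/-! ### Bounded `k`: sparse random datasets -/

lemma mass_row_apply_eq_one_le {d : ℕ} {p : ℝ} (h0 : 0 ≤ p) (h1 : p ≤ 1) (j : Fin d) :
    mass (prodWeight (signWeight p)) {r : Fin d → ℤˣ | r j = 1} ≤ p := by
  let g : Fin d → ℤˣ → ℝ := fun i u => if i = j then (if u = 1 then 1 else 0) else 1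
  have hg : ∀ i u, 0 ≤ g i u := by
    intro i u
    simp only [g]
    split_ifs <;> norm_num
  refine (mass_le_sum (prodWeight_nonneg (signWeight_nonneg h0 h1)) (f := fun r => ∏ i, g i (r i))
    (fun r => Finset.prod_nonneg fun i _ => hg _ _) fun r hr => ?_).trans ?_
  · have hr' : r j = 1 := hr
    refine le_of_eq (Finset.prod_eq_one fun i _ => ?_).symm
    by_cases hi : i = j
    · subst hi
      simp [g, hr']
    · simp [g, hi]
  · rw [sum_prodWeight_mul_prod]
    have : ∀ i, ∑ u, signWeight p u * g i u = if i = j then p else 1 := by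
      intro i
      by_cases hi : i = j
      · rw [sum_units]
        simp [g, hi, signWeight_one]
      · simpa [g, hi] using sum_signWeight p
    rw [Finset.prod_congr rfl fun i _ => this i]
    simp

/-- If the entries equal `1` with probability `p` and `d * p ^ n` is large compared with `k`, then
some `k` columns are identically `1`, so all selected columns are nearly so; but a fresh row has a
`1` in the first selected column only with probability `p`. -/
theorem not_exists_mechanism_of_sparse {n d k : ℕ} (hn : 0 < n) (hk : 1 ≤ k)
    {ε δ β α p : ℝ} (hp0 : 0 ≤ p) (hp1 : p ≤ 1) (hα0 : 0 ≤ α) (hα2 : α ≤ 2)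
    (hβ0 : 0 ≤ β) (hβ1 : β ≤ 1)
    (hlt : α / 2 + Real.exp (k - d * p ^ n / 2) + Real.exp ε * p < 1 - β - δ) :
    ¬ ∃ M : Mechanism n d, IsDifferentiallyPrivate ε δ M ∧ SolvesTopK k α β M := by
  classical
  have hn' : (0 : ℝ) < n := by exact_mod_cast hn
  refine not_exists_mechanism_of_test hn (w := prodWeight (signWeight p))
    (prodWeight_nonneg (signWeight_nonneg hp0 hp1)) (sum_prodWeight (sum_signWeight p))
    (fun T => {r | ∃ h : ∃ j, T j = true, r h.choose = 1}) (ρ := p) (fun T => ?_) hβ0 hβ1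
    (b := α / 2) (by linarith) (by linarith) (Real.exp_pos _).le ?_ hlt
  · by_cases hT : ∃ j, T j = true
    · refine le_trans (mass_mono (prodWeight_nonneg (signWeight_nonneg hp0 hp1)) ?_)
        (mass_row_apply_eq_one_le hp0 hp1 hT.choose)
      rintro r ⟨_, hr⟩
      exact hr
    · refine le_trans (le_of_eq (Finset.sum_eq_zero fun r _ => Set.indicator_of_notMem ?_ _)) hp0
      rintro ⟨h, _⟩
      exact hT h
  · have hq : p ^ n ≤ mass (prodWeight (signWeight p)) {(1 : Fin n → ℤˣ)} := by
      rw [mass, Finset.sum_eq_single (1 : Fin n → ℤˣ) (fun y _ hy => by simp [hy])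
        (fun h => absurd (Finset.mem_univ _) h)]
      simp [prodWeight, signWeight_one]
    refine le_trans (mass_mono (prodWeight_nonneg (prodWeight_nonneg (signWeight_nonneg hp0 hp1)))
      ?_) (mass_card_columns_lt_le hp0 hp1 _ hq k)
    rintro X ⟨T, hT, hcard⟩
    by_contra hX
    have hX' : k ≤ (Finset.univ.filter fun j =>
        (fun i => X i j) ∈ ({(1 : Fin n → ℤˣ)} : Set (Fin n → ℤˣ))).card := by
      by_contra h
      refine hX (show _ < k from lt_of_eq_of_lt ?_ (not_le.mp h))
      congr!
    have hcols : k ≤ (Finset.univ.filter fun j => (n : ℝ) ≤ ∑ i, ((X i j : ℤ) : ℝ)).card := by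
      refine hX'.trans (Finset.card_le_card fun j hj => ?_)
      rw [Finset.mem_filter] at hj ⊢
      refine ⟨hj.1, le_of_eq ?_⟩
      have : ∀ i, X i j = 1 := fun i => congrFun (Set.mem_singleton_iff.mp hj.2) i
      simp [this]
    have hex : ∃ j, T j = true := by
      obtain ⟨j, hj⟩ := Finset.card_pos.mp (lt_of_lt_of_le hk hT.1.ge)
      exact ⟨j, (Finset.mem_filter.mp hj).2⟩
    have hsum := hT.le_column_sum hn hk hcols hex.choose_spec
    have hones : ((Finset.univ.filter fun i => X i hex.choose = 1).card : ℝ) <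
        (1 - α / 2) * n := by
      refine lt_of_le_of_lt (Nat.cast_le.mpr (Finset.card_le_card fun i hi => ?_)) hcard
      exact (@Finset.mem_filter _ _ (_) _ _).mpr
        ⟨Finset.mem_univ i, hex, (Finset.mem_filter.mp hi).2⟩
    have hval : ∑ i, ((X i hex.choose : ℤ) : ℝ) =
        2 * ((Finset.univ.filter fun i => X i hex.choose = 1).card : ℝ) - n := by
      rw [Finset.card_filter, Nat.cast_sum, Finset.mul_sum]
      have hn1 : (n : ℝ) = ∑ _i : Fin n, (1 : ℝ) := by simp
      conv_rhs => rw [hn1]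
      rw [← Finset.sum_sub_distrib]
      refine Finset.sum_congr rfl fun i _ => ?_
      rcases Int.units_eq_one_or (X i hex.choose) with h | h <;> rw [h] <;> norm_num
    rw [hval] at hsum
    linarith

/-! ### Large `k`: uniformly random datasets -/

open Classical in
/-- If at least a `b` fraction of the rows correlate with the selected columns half as much as the
average row does, then the other rows carry an excess of correlation. A union bound over the
selected columns `J` and the set `B` of rows shows that this is unlikely. -/
lemma mass_exists_rectangle_le {n d k : ℕ} (hn : 0 < n) {b s : ℝ} (hb0 : 0 ≤ b) (hs : 0 ≤ s) :
    mass (prodWeight (prodWeight uniformSign))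
        {X : Dataset n d | ∃ c ∈ Finset.powersetCard k (Finset.univ : Finset (Fin d)) ×ˢ
          Finset.univ.filter (fun B : Finset (Fin n) => b * n ≤ (B.card : ℝ)),
          k * s - c.2.card * (k * s / (2 * n)) ≤ ∑ i ∈ c.2ᶜ, ∑ j ∈ c.1, ((X i j : ℤ) : ℝ)} ≤
      d ^ k * 2 ^ n * Real.exp (-(k * s ^ 2 / n * (1 / 2 + b ^ 2 / 8))) := by
  have hn' : (0 : ℝ) < n := by exact_mod_cast hn
  set E : ℝ := Real.exp (-(k * s ^ 2 / n * (1 / 2 + b ^ 2 / 8))) with hE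
  refine (mass_biUnion_le (prodWeight_nonneg (prodWeight_nonneg uniformSign_nonneg)) _
    fun c : Finset (Fin d) × Finset (Fin n) => {X : Dataset n d |
      k * s - c.2.card * (k * s / (2 * n)) ≤ ∑ i ∈ c.2ᶜ, ∑ j ∈ c.1, ((X i j : ℤ) : ℝ)}).trans ?_
  have hterm : ∀ c ∈ Finset.powersetCard k (Finset.univ : Finset (Fin d)) ×ˢ
      Finset.univ.filter (fun B : Finset (Fin n) => b * n ≤ (B.card : ℝ)),
      mass (prodWeight (prodWeight uniformSign)) {X : Dataset n d |
        k * s - c.2.card * (k * s / (2 * n)) ≤ ∑ i ∈ c.2ᶜ, ∑ j ∈ c.1, ((X i j : ℤ) : ℝ)} ≤ E := by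
    rintro ⟨J, B⟩ hc
    obtain ⟨hJ, hB⟩ := Finset.mem_product.mp hc
    have hJk : J.card = k := (Finset.mem_powersetCard.mp hJ).2
    have hBb : b * n ≤ (B.card : ℝ) := (Finset.mem_filter.mp hB).2
    -- Slightly above the parameter `s / n` that is optimal for the full rectangle.
    refine (mass_rectangle_sum_le (θ := s / n * (1 + b / 2)) (by positivity) Bᶜ J _).trans ?_
    refine Real.exp_le_exp.mpr ?_
    have hBc : (Bᶜ.card : ℝ) = n - B.card := by
      rw [Finset.card_compl, Fintype.card_fin, Nat.cast_sub (by simpa using B.card_le_univ)]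
    obtain ⟨x, hx⟩ : ∃ x : ℝ, (B.card : ℝ) = x * n := ⟨B.card / n, by field_simp⟩
    have hbx : b ≤ x := by
      rw [hx] at hBb
      exact le_of_mul_le_mul_right hBb hn'
    simp only [hBc, hJk, hx]
    have hid : (↑n - x * ↑n) * (↑k * ((s / ↑n * (1 + b / 2)) ^ 2 / 2)) -
        s / ↑n * (1 + b / 2) * (↑k * s - x * ↑n * (↑k * s / (2 * ↑n))) =
        -(k * s ^ 2 / n * (1 / 2 + b ^ 2 / 8)) -
          k * s ^ 2 / n * ((x - b) * (b / 2 * (1 + b / 2)) / 2 + b ^ 3 / 8) := by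
      field_simp
      ring
    rw [hid]
    have h1 : 0 ≤ (x - b) * (b / 2 * (1 + b / 2)) / 2 + b ^ 3 / 8 := by
      have := sub_nonneg.mpr hbx
      positivity
    have h2 : 0 ≤ k * s ^ 2 / n * ((x - b) * (b / 2 * (1 + b / 2)) / 2 + b ^ 3 / 8) := by
      positivity
    linarith
  refine (Finset.sum_le_sum hterm).trans ?_
  rw [Finset.sum_const, nsmul_eq_mul, Finset.card_product, Nat.cast_mul]
  have h1 : ((Finset.powersetCard k (Finset.univ : Finset (Fin d))).card : ℝ) ≤ d ^ k := by
    rw [Finset.card_powersetCard, Finset.card_univ, Fintype.card_fin]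
    exact_mod_cast Nat.choose_le_pow d k
  have h2 : ((Finset.univ.filter (fun B : Finset (Fin n) => b * n ≤ (B.card : ℝ))).card : ℝ) ≤
      2 ^ n := by
    have := Finset.card_filter_le (Finset.univ : Finset (Finset (Fin n)))
      (fun B => b * n ≤ (B.card : ℝ))
    rw [Finset.card_univ, Fintype.card_finset, Fintype.card_fin] at this
    exact_mod_cast this
  gcongr

/-- For uniformly random data: if `s'` is a lower bound on the sums of the columns in an accurate
output, then such an output has correlation at least `k * s' / (2 * n)` with most rows, and
correlation that large with a fresh row is rare. -/
theorem not_exists_mechanism_of_uniform {n d k : ℕ} (hn : 0 < n) (hk : 1 ≤ k)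
    {ε δ β α b s s' q : ℝ} (hs' : 0 ≤ s') (hss : s' ≤ s - α * n)
    (hq : q ≤ mass (prodWeight uniformSign) {x : Fin n → ℤˣ | s ≤ ∑ i, ((x i : ℤ) : ℝ)})
    (hb0 : 0 ≤ b) (hb1 : b ≤ 1) (hβ0 : 0 ≤ β) (hβ1 : β ≤ 1)
    (hlt : b + (Real.exp (k - d * q / 2) +
        d ^ k * 2 ^ n * Real.exp (-(k * s' ^ 2 / n * (1 / 2 + b ^ 2 / 8)))) +
      Real.exp ε * Real.exp (-(k * s' ^ 2 / (8 * n ^ 2))) < 1 - β - δ) :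
    ¬ ∃ M : Mechanism n d, IsDifferentiallyPrivate ε δ M ∧ SolvesTopK k α β M := by
  classical
  have hn' : (0 : ℝ) < n := by exact_mod_cast hn
  have hrow : ∀ r : Fin d → ℤˣ, 0 ≤ prodWeight uniformSign r :=
    prodWeight_nonneg uniformSign_nonneg
  set A : (Fin d → Bool) → Set (Fin d → ℤˣ) := fun T =>
    {r | (Finset.univ.filter fun j => T j = true).card = k ∧
      k * s' / (2 * n) ≤ ∑ j ∈ Finset.univ.filter fun j => T j = true, ((r j : ℤ) : ℝ)} with hA
  refine not_exists_mechanism_of_test hn hrow (sum_prodWeight (sum_signWeight _)) A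
    (ρ := Real.exp (-(k * s' ^ 2 / (8 * n ^ 2)))) (fun T => ?_) hβ0 hβ1 hb0 hb1
    (by positivity) ?_ hlt
  · by_cases hT : (Finset.univ.filter fun j => T j = true).card = k
    · refine ((mass_mono hrow fun r hr => hr.2).trans (mass_row_sum_le (θ := s' / (2 * n))
        (by positivity) (Finset.univ.filter fun j => T j = true) (k * s' / (2 * n)))).trans ?_
      rw [hT]
      refine Real.exp_le_exp.mpr (le_of_eq ?_)
      field_simp
      ring
    · refine le_trans (le_of_eq (Finset.sum_eq_zero fun r _ => Set.indicator_of_notMem ?_ _))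
        (Real.exp_pos _).le
      exact fun h => hT h.1
  · refine le_trans ?_ (add_le_add
      (mass_card_columns_lt_le (d := d) (by norm_num) (by norm_num) _ hq k)
      (mass_exists_rectangle_le (d := d) (k := k) hn hb0 hs'))
    refine le_trans (mass_mono (prodWeight_nonneg hrow) ?_)
      (mass_union_le (prodWeight_nonneg hrow) _ _)
    rintro X ⟨T, hT, hcard⟩
    by_cases hX : (Finset.univ.filter fun j => (fun i => X i j) ∈
        {x : Fin n → ℤˣ | s ≤ ∑ i, ((x i : ℤ) : ℝ)}).card < k
    · exact Or.inl hX
    right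
    have hcol : ∀ j, T j = true → s' ≤ ∑ i, ((X i j : ℤ) : ℝ) := fun j hj =>
      hss.trans (hT.le_column_sum hn hk (not_lt.mp hX) hj)
    set J : Finset (Fin d) := Finset.univ.filter fun j => T j = true with hJ
    set B : Finset (Fin n) := Finset.univ.filter fun i => X i ∉ A T with hB
    have hBc : Bᶜ = Finset.univ.filter fun i => X i ∈ A T := by
      ext i
      simp [hB]
    have hBcard : (B.card : ℝ) + ((Finset.univ.filter fun i => X i ∈ A T).card : ℝ) = n := by
      rw [← hBc]
      have := Finset.card_add_card_compl B
      rw [Fintype.card_fin] at this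
      exact_mod_cast this
    refine ⟨(J, B), Finset.mem_product.mpr ⟨Finset.mem_powersetCard.mpr
      ⟨Finset.subset_univ _, hT.1⟩, Finset.mem_filter.mpr ⟨Finset.mem_univ _, ?_⟩⟩, ?_⟩
    · have : ((Finset.univ.filter fun i => X i ∈ A T).card : ℝ) < (1 - b) * n := by
        convert hcard
      linarith
    · simp only
      have htot : (k : ℝ) * s' ≤ ∑ i, ∑ j ∈ J, ((X i j : ℤ) : ℝ) := by
        rw [Finset.sum_comm]
        calc (k : ℝ) * s' = ∑ _j ∈ J, s' := by rw [Finset.sum_const, hT.1, nsmul_eq_mul]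
          _ ≤ _ := Finset.sum_le_sum fun j hj => hcol j (Finset.mem_filter.mp hj).2
      have hlow : ∑ i ∈ B, ∑ j ∈ J, ((X i j : ℤ) : ℝ) ≤ B.card * (k * s' / (2 * n)) := by
        rw [← nsmul_eq_mul]
        refine Finset.sum_le_card_nsmul _ _ _ fun i hi => ?_
        by_contra hcon
        exact (Finset.mem_filter.mp hi).2 ⟨hT.1, (not_le.mp hcon).le⟩
      have := Finset.sum_add_sum_compl B fun i => ∑ j ∈ J, ((X i j : ℤ) : ℝ)
      linarith

/-! ### Choice of parameters -/

lemma IsSubpolynomial.eventually_le_rpow {k : ℕ → ℕ} (hk : IsSubpolynomial k) {κ : ℝ}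
    (hκ : 0 < κ) : ∀ᶠ d : ℕ in atTop, 1 ≤ k d ∧ (k d : ℝ) ≤ Real.exp (κ * Real.log d) := by
  obtain ⟨e, he, hke⟩ := hk
  filter_upwards [hke, he.eventually (gt_mem_nhds hκ), eventually_ge_atTop 1] with d h1 h2 h3
  have hd : (1 : ℝ) ≤ d := by exact_mod_cast h3
  have hd0 : (0 : ℝ) < d := by linarith
  constructor
  · have : (0 : ℝ) < k d := by rw [h1]; exact Real.rpow_pos_of_pos hd0 _
    exact_mod_cast this
  · rw [h1, Real.rpow_def_of_pos hd0]
    refine Real.exp_le_exp.mpr ?_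
    have := mul_le_mul_of_nonneg_left h2.le (Real.log_nonneg hd)
    linarith

/-- The probability that fewer than `k` columns are good is small once the expected number of good
columns is of order `y ^ 2` for some large `y ≥ k`. -/
lemma exp_sub_le {k a y D g : ℝ} (hg : 0 < g) (hy : 0 ≤ y) (hky : k ≤ y) (hD : a * y ^ 2 ≤ D)
    (hay : 2 ≤ a * y) (hgy : Real.log g⁻¹ ≤ y) : Real.exp (k - D) ≤ g := by
  rw [← Real.le_log_iff_exp_le hg]
  rw [Real.log_inv] at hgy
  nlinarith

/-- The regime of bounded `k`: with `n` a small multiple of `log d`, even constant error is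
impossible. -/
theorem eventually_not_exists_mechanism_sparse {ε δ β Δ c : ℝ} (hβ : 0 ≤ β)
    (hδ : 0 ≤ δ) (hΔ0 : 0 < Δ) (hΔ : Δ = 1 - β - δ)
    (hc0 : 0 < c) (hc : c * (4 * Real.log (Δ * Real.exp (-ε) / 4)⁻¹) = 1) :
    ∀ᶠ d : ℕ in atTop, ∀ k : ℕ, 1 ≤ k → (k : ℝ) ≤ Real.exp (1 / 4 * Real.log d) →
      ∀ α : ℝ, 0 ≤ α → α ≤ Δ / 2 →
        ¬ ∃ M : Mechanism ⌈c * Real.log d⌉₊ d,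
          IsDifferentiallyPrivate ε δ M ∧ SolvesTopK k α β M := by
  set p : ℝ := Δ * Real.exp (-ε) / 4 with hp
  have hp0 : 0 < p := by positivity
  set ℓ : ℝ := Real.log p⁻¹ with hℓ
  have hℓ0 : 0 < ℓ := by
    by_contra h
    nlinarith
  have hpℓ : p = Real.exp (-ℓ) := by rw [hℓ, Real.log_inv, neg_neg, Real.exp_log hp0]
  have hp1 : p ≤ 1 := by rw [hpℓ]; exact Real.exp_le_one_iff.mpr (by linarith)
  have hlog : Tendsto (fun d : ℕ => Real.log d) atTop atTop :=
    Real.tendsto_log_atTop.comp tendsto_natCast_atTop_atTop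
  have hexp : Tendsto (fun d : ℕ => Real.exp (1 / 4 * Real.log d)) atTop atTop :=
    Real.tendsto_exp_atTop.comp (hlog.const_mul_atTop (by norm_num))
  filter_upwards [hlog.eventually_gt_atTop 0, hexp.eventually_ge_atTop (4 / p),
    hexp.eventually_ge_atTop (Real.log (Δ / 4)⁻¹), eventually_gt_atTop 0] with d hL hy1 hy2 hd
  intro k hk hky α hα0 hα
  set L := Real.log d with hLd
  set y := Real.exp (1 / 4 * L)
  have hdL : (d : ℝ) = Real.exp L := (Real.exp_log (by exact_mod_cast hd)).symm
  have hn : 0 < ⌈c * L⌉₊ := Nat.ceil_pos.mpr (by positivity)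
  have hn1 : (⌈c * L⌉₊ : ℝ) ≤ c * L + 1 := (Nat.ceil_lt_add_one (by positivity)).le
  -- The choice of `c` makes `p ^ n` at least of order `d ^ (-1 / 4)`, while `y = d ^ (1 / 4)`.
  have hpn : p * y ^ 2 ≤ d * p ^ ⌈c * L⌉₊ := by
    rw [hdL, hpℓ, ← Real.exp_nat_mul, ← Real.exp_nat_mul, ← Real.exp_add, ← Real.exp_add]
    refine Real.exp_le_exp.mpr ?_
    have h1 := mul_le_mul_of_nonneg_right hn1 hℓ0.le
    have h2 : c * L * ℓ = L / 4 := by linear_combination (L / 4) * hc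
    push_cast
    nlinarith
  have hg : Real.exp (k - d * p ^ ⌈c * L⌉₊ / 2) ≤ Δ / 4 := by
    refine exp_sub_le (a := p / 2) (by positivity) (Real.exp_pos _).le hky (by linarith) ?_ hy2
    rw [div_le_iff₀ hp0] at hy1
    linarith
  have hρ : Real.exp ε * p = Δ / 4 := by
    have : Real.exp ε * Real.exp (-ε) = 1 := by rw [← Real.exp_add]; simp
    rw [hp]
    linear_combination (Δ / 4) * this
  refine not_exists_mechanism_of_sparse hn hk hp0.le hp1 hα0 (by linarith) hβ (by linarith) ?_
  rw [hρ]
  linarith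

/-- In the moderate deviation regime `1 ≪ L ≪ n`, a sum of `n` uniform signs exceeds
`(1 - η) * √(2 * L * n)` with probability at least of order `exp (-(1 - η / 2) * L)`. -/
lemma exp_le_mass_uniformSign_sqrt {n : ℕ} (hn : 4 ≤ n) {L η : ℝ} (hL : 0 < L) (hη0 : 0 < η)
    (hη1 : η ≤ 1) (hLη : 1152 ≤ L * η ^ 2) (hnL : 2048 * L ≤ n * η ^ 2) :
    1 / 2 * Real.exp (-((1 - η / 2) * L)) ≤ mass (prodWeight uniformSign)
      {x : Fin n → ℤˣ | (1 - η) * √(2 * L) * √n ≤ ∑ i, ((x i : ℤ) : ℝ)} := by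
  have hn0 : (0 : ℝ) < n := by exact_mod_cast (by omega : 0 < n)
  have hsn : √(n : ℝ) ^ 2 = n := Real.sq_sqrt hn0.le
  have hsn0 : 0 < √(n : ℝ) := Real.sqrt_pos.mpr hn0
  set u : ℝ := √(2 * L) with hu
  have hu0 : 0 ≤ u := Real.sqrt_nonneg _
  have huu : u ^ 2 = 2 * L := Real.sq_sqrt (by positivity)
  have hu48 : 48 ≤ η * u := by
    refine le_of_sq_le_sq ?_ (by positivity)
    rw [mul_pow, huu]
    linarith
  -- The tilt `γ` moves the mean of the sum to `(1 - η / 2) * √(2 * L * n)`, which leaves room for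
  -- the fluctuations of order `√n`.
  set γ : ℝ := (1 - η / 2) * (u / √n) with hγ
  have hr0 : 0 ≤ u / √n := by positivity
  have hr : u / √n ≤ η / 32 := by
    refine le_of_sq_le_sq ?_ (by positivity)
    rw [div_pow, huu, hsn, div_le_iff₀ hn0]
    linarith
  have hγ0 : 0 ≤ γ := mul_nonneg (by linarith) hr0
  have hγr : γ ≤ u / √n := mul_le_of_le_one_left hr0 (by linarith)
  have hγn : γ * √n = (1 - η / 2) * u := by rw [hγ]; field_simp
  have hγnn : n * γ = (1 - η / 2) * u * √n := by
    rw [← hγn]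
    linear_combination (-γ) * hsn
  have hγ2 : n * γ ^ 2 = (1 - η / 2) ^ 2 * (2 * L) := by
    calc n * γ ^ 2 = (γ * √n) ^ 2 := by rw [mul_pow γ, hsn, mul_comm]
      _ = _ := by rw [hγn, mul_pow, huu]
  refine le_trans ?_ ((exp_le_mass_uniformSign hn hγ0 (by linarith)).trans
    (mass_mono (prodWeight_nonneg uniformSign_nonneg) fun x hx => ?_))
  · refine mul_le_mul_of_nonneg_left (Real.exp_le_exp.mpr (neg_le_neg ?_)) (by norm_num)
    have h1 : 3 * γ * √n ≤ η / 8 * L := by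
      rw [mul_assoc, hγn]
      have h2 := mul_le_mul_of_nonneg_right hu48 hu0
      have h3 : η * u * u = η * (2 * L) := by rw [← huu]; ring
      have h4 := mul_nonneg hη0.le hu0
      linarith
    have h2 : 2 * n * γ ^ 3 ≤ η / 8 * L := by
      have h3 : n * γ ^ 2 ≤ 2 * L := by
        rw [hγ2]
        exact mul_le_of_le_one_left (by linarith) (pow_le_one₀ (by linarith) (by linarith))
      have h4 : γ ≤ η / 32 := hγr.trans hr
      calc 2 * n * γ ^ 3 = 2 * ((n * γ ^ 2) * γ) := by ring
        _ ≤ 2 * ((2 * L) * (η / 32)) := by gcongr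
        _ = η / 8 * L := by ring
    have h5 : n * γ ^ 2 / 2 ≤ (1 - 3 / 4 * η) * L := by
      have h6 : (1 - η / 2) ^ 2 ≤ 1 - 3 / 4 * η := by nlinarith
      have h7 := mul_le_mul_of_nonneg_right h6 hL.le
      rw [hγ2]
      linarith
    linarith
  · have hx' : n * γ - 3 * √n ≤ ∑ i, ((x i : ℤ) : ℝ) := hx
    refine le_trans ?_ hx'
    rw [hγnn]
    have h8 := mul_le_mul_of_nonneg_right hu48 hsn0.le
    linarith

/-- Impossibility for large `k` and finite `d`, with all requirements on the parameters explicit: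
`b` is the tolerated fraction of uncorrelated rows and `η` the relative slack in the column sums. -/
theorem not_exists_mechanism_of_log {n d k : ℕ} {ε δ β α Δ b η c L : ℝ} (hβ : 0 ≤ β) (hδ : 0 ≤ δ)
    (hΔ0 : 0 < Δ) (hΔ : Δ = 1 - β - δ) (hb : b = Δ / 4) (hη : η = b ^ 2 / 64)
    (hc0 : 0 < c) (hcb : c ≤ b ^ 2 / 16) (hcε : c * (16 * (ε + Real.log (Δ / 8)⁻¹)) ≤ 1)
    (hL : 0 < L) (hdL : (d : ℝ) = Real.exp L) (hk : 1 ≤ k)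
    (hky : (k : ℝ) ≤ Real.exp (η / 4 * L)) (hkK : 2048 ≤ k * (c * η ^ 2))
    (hnlo : c * (k * L) ≤ n) (hnhi : (n : ℝ) ≤ c * (k * L) + 1)
    (hα : α ≤ √2 * η * √(L / n)) (hLc : 4 ≤ L * c) (hLη : 1152 ≤ L * η ^ 2)
    (hLb : 1 + Real.log (Δ / 8)⁻¹ ≤ L * (b ^ 2 / 16)) (hy1 : 8 ≤ Real.exp (η / 4 * L))
    (hy2 : Real.log (Δ / 8)⁻¹ ≤ Real.exp (η / 4 * L)) :
    ¬ ∃ M : Mechanism n d, IsDifferentiallyPrivate ε δ M ∧ SolvesTopK k α β M := by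
  have hb0 : 0 < b := by linarith
  have hb1 : b ≤ 1 / 4 := by linarith
  have hbb : b ^ 2 ≤ 1 / 16 := by
    calc b ^ 2 ≤ (1 / 4) ^ 2 := pow_le_pow_left₀ hb0.le hb1 2
      _ = 1 / 16 := by norm_num
  have hη0 : 0 < η := by rw [hη]; positivity
  have hη1 : η ≤ 1 / 64 := by linarith
  have hk1 : (1 : ℝ) ≤ k := by exact_mod_cast hk
  have hkL : L ≤ k * L := le_mul_of_one_le_left hL.le hk1
  have hkL0 : 0 < k * L := by positivity
  have hckL : 4 ≤ c * (k * L) := by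
    have := mul_le_mul_of_nonneg_left hkL hc0.le
    linarith
  have hn4 : (4 : ℝ) ≤ n := by linarith
  have hn4' : 4 ≤ n := by exact_mod_cast hn4
  have hn0 : (0 : ℝ) < n := by linarith
  have hsn : √(n : ℝ) ^ 2 = n := Real.sq_sqrt hn0.le
  have hsn0 : 0 < √(n : ℝ) := Real.sqrt_pos.mpr hn0
  have huu : √(2 * L) ^ 2 = 2 * L := Real.sq_sqrt (by positivity)
  obtain ⟨s, hs⟩ : ∃ s : ℝ, s = (1 - η) * √(2 * L) * √n := ⟨_, rfl⟩
  obtain ⟨s', hs'⟩ : ∃ s' : ℝ, s' = (1 - 2 * η) * √(2 * L) * √n := ⟨_, rfl⟩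
  obtain ⟨q, hq⟩ : ∃ q : ℝ, q = 1 / 2 * Real.exp (-((1 - η / 2) * L)) := ⟨_, rfl⟩
  have hs'0 : 0 ≤ s' := by
    rw [hs']
    exact mul_nonneg (mul_nonneg (by linarith) (Real.sqrt_nonneg _)) hsn0.le
  have hs'2 : s' ^ 2 = (1 - 2 * η) ^ 2 * (2 * L) * n := by
    rw [hs', mul_pow, mul_pow, huu, hsn]
  have hss : s' ≤ s - α * n := by
    have h1 : α * n ≤ √2 * η * √(L / n) * n := mul_le_mul_of_nonneg_right hα hn0.le
    have h2 : √2 * η * √(L / n) * n = η * √(2 * L) * √n := by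
      rw [Real.sqrt_div hL.le, Real.sqrt_mul (by norm_num)]
      field_simp
      rw [hsn]
    rw [hs, hs']
    linarith
  have hqmass : q ≤ mass (prodWeight uniformSign)
      {x : Fin n → ℤˣ | s ≤ ∑ i, ((x i : ℤ) : ℝ)} := by
    rw [hq, hs]
    refine exp_le_mass_uniformSign_sqrt hn4' hL hη0 (by linarith) hLη ?_
    have h1 := mul_le_mul_of_nonneg_right hkK hL.le
    have h2 := mul_le_mul_of_nonneg_left hnlo (sq_nonneg η)
    linarith
  have hΔexp : Real.exp (-Real.log (Δ / 8)⁻¹) = Δ / 8 := by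
    rw [Real.log_inv, neg_neg, Real.exp_log (by positivity)]
  have hg1 : Real.exp (k - d * q / 2) ≤ Δ / 8 := by
    refine exp_sub_le (a := 1 / 4) (by positivity) (Real.exp_pos _).le hky (le_of_eq ?_)
      (by linarith) hy2
    have : Real.exp ((2 : ℕ) * (η / 4 * L)) = Real.exp L * Real.exp (-((1 - η / 2) * L)) := by
      rw [← Real.exp_add]
      congr 1
      push_cast
      ring
    rw [hq, hdL, ← Real.exp_nat_mul, this]
    ring
  have hη4 : 1 - 4 * η ≤ (1 - 2 * η) ^ 2 := by linarith [sq_nonneg η]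
  have hgap : 1 + b ^ 2 / 8 ≤ (1 - 2 * η) ^ 2 * (1 + b ^ 2 / 4) := by
    have h2 := mul_le_mul_of_nonneg_right hη4 (by positivity : 0 ≤ 1 + b ^ 2 / 4)
    have h3 := mul_le_mul_of_nonneg_left hbb (sq_nonneg b)
    rw [hη] at h2 ⊢
    linarith
  have hg2 : (d : ℝ) ^ k * 2 ^ n * Real.exp (-(k * s' ^ 2 / n * (1 / 2 + b ^ 2 / 8))) ≤
      Δ / 8 := by
    have h2e : (2 : ℝ) ≤ Real.exp 1 := by linarith [Real.add_one_le_exp (1 : ℝ)]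
    have hexponent : k * s' ^ 2 / n * (1 / 2 + b ^ 2 / 8) =
        k * L * ((1 - 2 * η) ^ 2 * (1 + b ^ 2 / 4)) := by
      rw [hs'2]
      field_simp
      ring
    calc (d : ℝ) ^ k * 2 ^ n * Real.exp (-(k * s' ^ 2 / n * (1 / 2 + b ^ 2 / 8)))
        ≤ Real.exp L ^ k * Real.exp 1 ^ n *
          Real.exp (-(k * s' ^ 2 / n * (1 / 2 + b ^ 2 / 8))) := by
          rw [hdL]
          gcongr
      _ = Real.exp (k * L + n - k * L * ((1 - 2 * η) ^ 2 * (1 + b ^ 2 / 4))) := by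
          rw [← Real.exp_nat_mul, ← Real.exp_nat_mul, ← Real.exp_add, ← Real.exp_add, hexponent,
            mul_one, ← sub_eq_add_neg]
      _ ≤ Real.exp (-Real.log (Δ / 8)⁻¹) := by
          refine Real.exp_le_exp.mpr ?_
          have h1 := mul_le_mul_of_nonneg_left hgap hkL0.le
          have h2 := mul_le_mul_of_nonneg_right hcb hkL0.le
          have h3 := mul_le_mul_of_nonneg_right hkL (by positivity : 0 ≤ b ^ 2 / 16)
          linarith
      _ = Δ / 8 := hΔexp
  have hρ : Real.exp ε * Real.exp (-(k * s' ^ 2 / (8 * n ^ 2))) ≤ Δ / 8 := by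
    rw [← Real.exp_add, ← hΔexp]
    refine Real.exp_le_exp.mpr ?_
    have h1 : ε + Real.log (Δ / 8)⁻¹ ≤ k * s' ^ 2 / (8 * n ^ 2) := by
      have h2 : k * s' ^ 2 / (8 * n ^ 2) = (1 - 2 * η) ^ 2 * (k * L / (4 * n)) := by
        rw [hs'2]
        field_simp
        ring
      have h3 : 1 / 2 ≤ (1 - 2 * η) ^ 2 := by linarith
      have h4 : 1 / (8 * c) ≤ k * L / (4 * n) := by
        rw [div_le_div_iff₀ (by positivity) (by positivity)]
        linarith
      calc ε + Real.log (Δ / 8)⁻¹ ≤ 1 / (16 * c) := by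
            rw [le_div_iff₀ (by positivity)]
            linarith
        _ = 1 / 2 * (1 / (8 * c)) := by field_simp; norm_num
        _ ≤ (1 - 2 * η) ^ 2 * (k * L / (4 * n)) := by gcongr
        _ = _ := h2.symm
    linarith
  refine not_exists_mechanism_of_uniform (by omega) hk hs'0 hss hqmass hb0.le (by linarith) hβ
    (by linarith) ?_
  linarith

/-- The regime of large `k`: with `n` a small multiple of `k * log d`, error a small multiple of
`√(log d / n)` is impossible. -/
theorem eventually_not_exists_mechanism_uniform {ε δ β Δ b η c : ℝ} (hβ : 0 ≤ β)
    (hδ : 0 ≤ δ) (hΔ0 : 0 < Δ) (hΔ : Δ = 1 - β - δ) (hb : b = Δ / 4) (hη : η = b ^ 2 / 64)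
    (hc0 : 0 < c) (hcb : c ≤ b ^ 2 / 16)
    (hcε : c * (16 * (ε + Real.log (Δ / 8)⁻¹)) ≤ 1) :
    ∀ᶠ d : ℕ in atTop, ∀ k : ℕ, 1 ≤ k → (k : ℝ) ≤ Real.exp (η / 4 * Real.log d) →
      2048 / (c * η ^ 2) ≤ k → ∀ n : ℕ, n = ⌈c * (k * Real.log d)⌉₊ →
        ∀ α : ℝ, α ≤ √2 * η * √(Real.log d / n) →
          ¬ ∃ M : Mechanism n d, IsDifferentiallyPrivate ε δ M ∧ SolvesTopK k α β M := by
  have hb0 : 0 < b := by linarith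
  have hη0 : 0 < η := by rw [hη]; positivity
  have hlog : Tendsto (fun d : ℕ => Real.log d) atTop atTop :=
    Real.tendsto_log_atTop.comp tendsto_natCast_atTop_atTop
  have hexp : Tendsto (fun d : ℕ => Real.exp (η / 4 * Real.log d)) atTop atTop :=
    Real.tendsto_exp_atTop.comp (hlog.const_mul_atTop (by positivity))
  filter_upwards [hlog.eventually_gt_atTop 0, hlog.eventually_ge_atTop (4 / c),
    hlog.eventually_ge_atTop (1152 / η ^ 2),
    hlog.eventually_ge_atTop ((1 + Real.log (Δ / 8)⁻¹) / (b ^ 2 / 16)),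
    hexp.eventually_ge_atTop 8, hexp.eventually_ge_atTop (Real.log (Δ / 8)⁻¹),
    eventually_gt_atTop 0] with d hL hLc hLη hLb hy1 hy2 hd
  intro k hk hky hkK n hn α hα
  refine not_exists_mechanism_of_log hβ hδ hΔ0 hΔ hb hη hc0 hcb hcε hL
    (Real.exp_log (by exact_mod_cast hd)).symm hk hky ((div_le_iff₀ (by positivity)).mp hkK)
    ?_ ?_ hα ((div_le_iff₀ hc0).mp hLc) ((div_le_iff₀ (by positivity)).mp hLη)
    ((div_le_iff₀ (by positivity)).mp hLb) hy1 hy2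
  · rw [hn]
    exact Nat.le_ceil _
  · rw [hn]
    exact (Nat.ceil_lt_add_one (by positivity)).le

end TopK

end

theorem theorem1 (ε δ β : ℝ) (hε : 0 ≤ ε) (hδ : 0 ≤ δ) (hβ : 0 ≤ β) (hδβ : δ + β < 1) :
    ∃ (n : ℕ → ℕ → ℕ) (α : ℕ → ℕ → ℝ),
      (∃ c : ℝ, 0 < c ∧ ∀ d k : ℕ, c * ((k : ℝ) * Real.log d) ≤ (n d k : ℝ)) ∧
      (∃ c : ℝ, 0 < c ∧ ∀ d k : ℕ, c * Real.sqrt (Real.log d / (n d k : ℝ)) ≤ α d k) ∧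
      ∀ k : ℕ → ℕ, TopK.IsSubpolynomial k → ∀ᶠ d : ℕ in atTop,
        ¬ ∃ M : TopK.Mechanism (n d (k d)) d,
          TopK.IsDifferentiallyPrivate ε δ M ∧
            TopK.SolvesTopK (k d) (α d (k d)) β M := by
  obtain ⟨Δ, hΔ⟩ : ∃ Δ : ℝ, Δ = 1 - β - δ := ⟨_, rfl⟩
  have hΔ0 : 0 < Δ := by linarith
  have hexpε : Real.exp (-ε) ≤ 1 := Real.exp_le_one_iff.mpr (by linarith)
  have hℓ : 0 < Real.log (Δ * Real.exp (-ε) / 4)⁻¹ := by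
    refine Real.log_pos ((one_lt_inv₀ (by positivity)).mpr ?_)
    nlinarith [Real.exp_pos (-ε)]
  have hR : 0 < ε + Real.log (Δ / 8)⁻¹ := by
    have : 0 < Real.log (Δ / 8)⁻¹ :=
      Real.log_pos ((one_lt_inv₀ (by positivity)).mpr (by linarith))
    linarith
  set ℓ := Real.log (Δ * Real.exp (-ε) / 4)⁻¹ with hℓd
  set R := ε + Real.log (Δ / 8)⁻¹ with hRd
  -- The constants are made opaque, so that later tactics do not unfold them: `c₁` and `c₂` govern
  -- `n` below and above the threshold `K` for `k`, and `a` is the constant in `α`.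
  obtain ⟨b, hb⟩ : ∃ b : ℝ, b = Δ / 4 := ⟨_, rfl⟩
  obtain ⟨η, hη⟩ : ∃ η : ℝ, η = b ^ 2 / 64 := ⟨_, rfl⟩
  have hb0 : 0 < b := by linarith
  have hη0 : 0 < η := by rw [hη]; positivity
  obtain ⟨c₁, hc₁⟩ : ∃ c₁ : ℝ, c₁ = 1 / (4 * ℓ) := ⟨_, rfl⟩
  have hc₁0 : 0 < c₁ := by rw [hc₁]; positivity
  have hc₁ℓ : c₁ * (4 * ℓ) = 1 := by rw [hc₁]; field_simp
  obtain ⟨c₂, hc₂⟩ : ∃ c₂ : ℝ, c₂ = min (b ^ 2 / 16) (1 / (16 * R)) := ⟨_, rfl⟩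
  have hc₂0 : 0 < c₂ := by rw [hc₂]; exact lt_min (by positivity) (by positivity)
  have hc₂b : c₂ ≤ b ^ 2 / 16 := hc₂ ▸ min_le_left _ _
  have hc₂R : c₂ * (16 * R) ≤ 1 := by
    rw [← le_div_iff₀ (by positivity), hc₂]
    exact min_le_right _ _
  -- From `K` on, `log d / n` is so small that the Gaussian tail bounds are sharp enough.
  obtain ⟨K, hK⟩ : ∃ K : ℝ, K = 2048 / (c₂ * η ^ 2) := ⟨_, rfl⟩
  have hK0 : 0 < K := by rw [hK]; positivity
  obtain ⟨a, ha⟩ : ∃ a : ℝ, a = min (√2 * η) (Δ / 2 * √c₁) := ⟨_, rfl⟩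
  have ha0 : 0 < a := by rw [ha]; exact lt_min (by positivity) (by positivity)
  obtain ⟨n, hn⟩ : ∃ n : ℕ → ℕ → ℕ, n = fun (d k : ℕ) =>
    if (k : ℝ) < K then ⌈c₁ * Real.log d⌉₊ else ⌈c₂ * (k * Real.log d)⌉₊ := ⟨_, rfl⟩
  have hnsmall : ∀ d k : ℕ, (k : ℝ) < K → n d k = ⌈c₁ * Real.log d⌉₊ := fun d k h => by
    rw [hn]; exact if_pos h
  have hnlarge : ∀ d k : ℕ, ¬ (k : ℝ) < K → n d k = ⌈c₂ * (k * Real.log d)⌉₊ := fun d k h => by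
    rw [hn]; exact if_neg h
  refine ⟨n, fun d k => a * √(Real.log d / n d k), ⟨min (c₁ / K) c₂, lt_min (by positivity) hc₂0,
    fun d k => ?_⟩, ⟨a, ha0, fun d k => le_rfl⟩, fun k hk => ?_⟩
  · have hL : 0 ≤ Real.log d := Real.log_natCast_nonneg d
    by_cases h : (k : ℝ) < K
    · rw [hnsmall d k h]
      refine le_trans ?_ (Nat.le_ceil _)
      calc min (c₁ / K) c₂ * (k * Real.log d) ≤ c₁ / K * (K * Real.log d) := by
            gcongr
            exact min_le_left _ _
        _ = c₁ * Real.log d := by field_simp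
    · rw [hnlarge d k h]
      refine le_trans ?_ (Nat.le_ceil _)
      gcongr
      exact min_le_right _ _
  · have hlog : Tendsto (fun d : ℕ => Real.log d) atTop atTop :=
      Real.tendsto_log_atTop.comp tendsto_natCast_atTop_atTop
    filter_upwards [hlog.eventually_gt_atTop 0, hk.eventually_le_rpow (κ := 1 / 4) (by norm_num),
      hk.eventually_le_rpow (κ := η / 4) (by positivity),
      TopK.eventually_not_exists_mechanism_sparse hβ hδ hΔ0 hΔ hc₁0 hc₁ℓ,
      TopK.eventually_not_exists_mechanism_uniform hβ hδ hΔ0 hΔ hb hη hc₂0 hc₂b hc₂R]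
      with d hL hk1 hk2 hsparse huniform
    by_cases h : (k d : ℝ) < K
    · have hα : a * √(Real.log d / n d (k d)) ≤ Δ / 2 := by
        have hnlo : c₁ * Real.log d ≤ n d (k d) := by
          rw [hnsmall d _ h]; exact Nat.le_ceil _
        have hle : Real.log d / n d (k d) ≤ 1 / c₁ := by
          have : (0 : ℝ) < n d (k d) := lt_of_lt_of_le (by positivity) hnlo
          rw [div_le_div_iff₀ this hc₁0]
          linarith
        calc a * √(Real.log d / n d (k d)) ≤ Δ / 2 * √c₁ * √(1 / c₁) := by
              gcongr
              rw [ha]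
              exact min_le_right _ _
          _ = Δ / 2 * √(c₁ * (1 / c₁)) := by rw [Real.sqrt_mul hc₁0.le]; ring
          _ = Δ / 2 := by rw [mul_one_div_cancel hc₁0.ne', Real.sqrt_one, mul_one]
      have hmain := hsparse (k d) hk1.1 hk1.2 _ (by positivity) hα
      rw [← hnsmall d _ h] at hmain
      exact hmain
    · refine huniform (k d) hk1.1 hk2.2 (by rw [← hK]; exact not_lt.mp h) _ (hnlarge d _ h) _ ?_
      gcongr
      rw [ha]
      exact min_le_left _ _
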